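/- Let $\mathbb F$ be a field of characteristic zero and let $W_4(\mathbb F)$ be the Lie algebra of all $\mathbb F$-derivations of the polynomial ring $\mathbb F[x,y,z,t]$, with bracket $[D_1,D_2]=D_1D_2-D_2D_1$. The problem of classifying, up to isomorphism of Lie algebras, the finite-dimensional nilpotent subalgebras of $W_4(\mathbb F)$ is wild, that is, it contains the problem of classifying pairs of square matrices of the same size over $\mathbb F$ up to similarity $(A,B)\mapsto(S^{-1}AS,S^{-1}BS)$, $S$ nonsingular. Explicitly: there are integers $r,k,l\ge 0$, derivations $G_s\in W_4(\mathbb F)$ ($1\le s\le r$) and $E_{d,i}\in W_4(\mathbb F)$ ($1\le d\le l$, $i\ge 1$), and an $l\times k$ matrix $(T_{dc})$ whose entries are noncommutative polynomials in two variables over $\mathbb F$, such that the following holds. For every $n\ge 0$ and every pair $(A,B)$ of $n\times n$ matrices over $\mathbb F$, the derivations $$G_s\ (1\le s\le r),\qquad \sum_{d=1}^{l}\sum_{i=1}^{n}\bigl[T_{dc}(A,B)\bigr]_{ij}\,E_{d,i}\ \ (1\le c\le k,\ 1\le j\le n)$$ form a basis of a nilpotent Lie subalgebra $L(A,B)$ of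 $W_4(\mathbb F)$; and for any two matrix pairs $(A,B)$ and $(C,D)$, of equal or different sizes, the Lie algebras $L(A,B)$ and $L(C,D)$ are isomorphic if and only if $(A,B)$ and $(C,D)$ have the same size and are similar, i.e. $(C,D)=(S^{-1}AS,S^{-1}BS)$ for some nonsingular $S$. -/

import Mathlib

/-- The Lie algebra `W_n(F)` of all `F`-derivations of the polynomial ring in `n` variables, with
the commutator bracket `[D₁, D₂] = D₁ D₂ - D₂ D₁`. -/
abbrev WittAlgebra (n : ℕ) (F : Type*) [Field F] : Type _ :=
  Derivation F (MvPolynomial (Fin n) F) (MvPolynomial (Fin n) F)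

/-- A pair of square matrices of the same size over `F`; the size is arbitrary. -/
structure MatrixPair (F : Type*) where
  /-- the common size of the two matrices -/
  size : ℕ
  /-- the first matrix -/
  fst : Matrix (Fin size) (Fin size) F
  /-- the second matrix -/
  snd : Matrix (Fin size) (Fin size) F

/-- Simultaneous similarity: `(A, B)` is related exactly to the pairs `(S⁻¹ A S, S⁻¹ B S)` with `S`
nonsingular.  Pairs of different sizes are never similar. -/
inductive MatrixPair.Similar {F : Type*} [Field F] : MatrixPair F → MatrixPair F → Prop
  | conj (n : ℕ) (A B : Matrix (Fin n) (Fin n) F) (S : GL (Fin n) F) :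
      MatrixPair.Similar ⟨n, A, B⟩
        ⟨n, (S⁻¹).val * A * S.val, (S⁻¹).val * B * S.val⟩

/-- The value `f(A, B)` of a noncommutative polynomial `f` in two variables at a matrix pair. -/
noncomputable def MatrixPair.eval {F : Type*} [Field F] (p : MatrixPair F)
    (f : FreeAlgebra F (Fin 2)) : Matrix (Fin p.size) (Fin p.size) F :=
  FreeAlgebra.lift F ![p.fst, p.snd] f

/-- A template producing, from a matrix pair of any size `n`, a finite family of vectors of `W`.
The family consists of `fixedCount` vectors that do not depend on the pair and of `blockCols`
blocks of `n` vectors.  The coordinate matrix of the latter, with respect to the vectors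
`frame d i` (`d < blockRows`, `i < n`), is a block matrix with blocks of size `n × n`, and its
blocks are noncommutative polynomials in the two matrices.
All data of the template are independent of the pair and of its size. -/
structure PairTemplate (F : Type*) [Field F] (W : Type*) where
  /-- the number of vectors that do not depend on the pair -/
  fixedCount : ℕ
  /-- the number of block rows -/
  blockRows : ℕ
  /-- the number of block columns -/
  blockCols : ℕ
  /-- the vectors that do not depend on the pair -/
  fixedVec : Fin fixedCount → W
  /-- the vectors with respect to which coordinates are given -/
  frame : Fin blockRows → ℕ → W
  /-- the block matrix of noncommutative polynomials -/
  block : Matrix (Fin blockRows) (Fin blockCols) (FreeAlgebra F (Fin 2))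

/-- The family of vectors that a template produces from a matrix pair. -/
noncomputable def PairTemplate.vec {F : Type*} [Field F] {W : Type*} [AddCommGroup W] [Module F W]
    (Θ : PairTemplate F W) (p : MatrixPair F) :
    Fin Θ.fixedCount ⊕ (Fin Θ.blockCols × Fin p.size) → W
  | Sum.inl s => Θ.fixedVec s
  | Sum.inr (c, j) =>
      ∑ d : Fin Θ.blockRows, ∑ i : Fin p.size, p.eval (Θ.block d c) i j • Θ.frame d i

/-- Wildness of the problem of classifying, up to isomorphism of Lie algebras, those Lie
subalgebras of `W` that have the property `P`: the problem contains the problem of classifying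
matrix pairs up to similarity.  That is, one template produces from every matrix pair `p` a basis
of a Lie subalgebra `L p` with the property `P`, in such a way that `L p` and `L q` are isomorphic
if and only if the matrix pairs `p` and `q` are similar. -/
def IsWildSubalgebraProblem (F : Type*) [Field F] (W : Type*) [LieRing W] [LieAlgebra F W]
    (P : LieSubalgebra F W → Prop) : Prop :=
  ∃ (Θ : PairTemplate F W) (L : MatrixPair F → LieSubalgebra F W),
    (∀ p : MatrixPair F,
      P (L p) ∧
      LinearIndependent F (Θ.vec p) ∧
      (L p).toSubmodule = Submodule.span F (Set.range (Θ.vec p))) ∧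
    ∀ p q : MatrixPair F, Nonempty (L p ≃ₗ⁅F⁆ L q) ↔ MatrixPair.Similar p q

/-!
A matrix pair `(A, B)` of size `n` is encoded in the Lie algebra `L = ⟨∂/∂x, ∂/∂y⟩ ⋉ M`, where `M`
is an abelian ideal of vector fields `f ∂/∂t` with `f` a polynomial in `x, y, z`.  The powers of `z`
only label the coordinates of `V = F ^ n`, so `f` is a polynomial in `x, y` with values in `V`, and
is described by the array of its Taylor coefficients `f i j` (`ShiftAlgebra`).  The ideal `M`
contains all `f` of degree at most `7` in `x, y` and at most `5` in `y`, and in degree `8`, for each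
`v` in `V`, the polynomial with Taylor coefficients
`f 3 5 = v, f 4 4 = 0, f 5 3 = v, f 6 2 = v, f 7 1 = A v, f 8 0 = B v` (`MatrixPair.model`).
Similar pairs obviously give isomorphic algebras (`MatrixPair.Similar.nonempty_model_equiv`).

Conversely, let `φ` be an isomorphism from the algebra of `(A, B)` to that of `(C, D)`.  For `n > 0`
the ideal `M` is the set of `a` with `(ad a) ^ 2 = 0`, and `M + F ∂/∂y` is the set of `a` with
`(ad a) ^ 7 = 0`: the degree in `y` is at most `5`, but `x ^ 7 v` lies in `M`.  Hence modulo `M` the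
map `φ` sends `∂/∂x` to `a ∂/∂x + c ∂/∂y` and `∂/∂y` to `b ∂/∂y`.  The elements of `M` killed by both
derivatives are the constants, so `φ` induces an injective linear map `S` between the spaces `V`.
All derivatives of order `8` of elements of `M` are constant; comparing those of the degree `8`
polynomial of `v` with those of its image, whose entry at `(3, 5)` is called `w`, gives
`S v = a ^ 3 b ^ 5 w` from the entry at `(3, 5)`, then `c = 0` from the entry at `(4, 4)`, then
`a ^ 3 b ^ 5 = a ^ 5 b ^ 3 = a ^ 6 b ^ 2` and so `a = b` from the next two, and finally `S A = C S`
and `S B = D S` (`MatrixPair.exists_intertwiner`).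
-/

/-! ### The semidirect product of two commuting shifts with a space of arrays -/

/-- The semidirect product of the abelian Lie algebra `F²` with the abelian Lie algebra of all
arrays `ℕ → ℕ → V`.  The two basis vectors of `F²` act on arrays by the shifts
`f ↦ f (· + 1) ·` and `f ↦ f · (· + 1)`: an array is thought of as the family of Taylor
coefficients of a polynomial in `x, y` with values in `V`, and the shifts are `∂/∂x` and `∂/∂y`. -/
def ShiftAlgebra (F V : Type*) : Type _ := F × F × (ℕ → ℕ → V)

namespace ShiftAlgebra

variable {F V : Type*}

/-- The element `α ∂/∂x + β ∂/∂y + f`. -/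
def of (α β : F) (f : ℕ → ℕ → V) : ShiftAlgebra F V := (α, β, f)

/-- The coefficient of the first shift. -/
def cx (a : ShiftAlgebra F V) : F := a.1

/-- The coefficient of the second shift. -/
def cy (a : ShiftAlgebra F V) : F := a.2.1

/-- The array component. -/
def array (a : ShiftAlgebra F V) : ℕ → ℕ → V := a.2.2

@[simp] theorem cx_of (α β : F) (f : ℕ → ℕ → V) : (of α β f).cx = α := rfl
@[simp] theorem cy_of (α β : F) (f : ℕ → ℕ → V) : (of α β f).cy = β := rfl
@[simp] theorem array_of (α β : F) (f : ℕ → ℕ → V) : (of α β f).array = f := rfl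

@[ext] theorem ext {a b : ShiftAlgebra F V} (h₁ : a.cx = b.cx) (h₂ : a.cy = b.cy)
    (h₃ : ∀ i j, a.array i j = b.array i j) : a = b :=
  Prod.ext h₁ (Prod.ext h₂ (funext fun i => funext fun j => h₃ i j))

variable [Field F] [AddCommGroup V]

instance : AddCommGroup (ShiftAlgebra F V) :=
  inferInstanceAs (AddCommGroup (F × F × (ℕ → ℕ → V)))

@[simp] theorem cx_zero : (0 : ShiftAlgebra F V).cx = 0 := rfl
@[simp] theorem cy_zero : (0 : ShiftAlgebra F V).cy = 0 := rfl
@[simp] theorem array_zero (i j : ℕ) : (0 : ShiftAlgebra F V).array i j = 0 := rfl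
@[simp] theorem cx_add (a b : ShiftAlgebra F V) : (a + b).cx = a.cx + b.cx := rfl
@[simp] theorem cy_add (a b : ShiftAlgebra F V) : (a + b).cy = a.cy + b.cy := rfl
@[simp] theorem array_add (a b : ShiftAlgebra F V) (i j : ℕ) :
    (a + b).array i j = a.array i j + b.array i j := rfl

/-- The array with the single nonzero entry `v` at `(i₀, j₀)`. -/
def single (F : Type*) [Field F] {V : Type*} [AddCommGroup V] (i₀ j₀ : ℕ) (v : V) :
    ShiftAlgebra F V :=
  of 0 0 fun i j => if i = i₀ ∧ j = j₀ then v else 0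

@[simp] theorem cx_single (i₀ j₀ : ℕ) (v : V) : (single F i₀ j₀ v).cx = 0 := rfl
@[simp] theorem cy_single (i₀ j₀ : ℕ) (v : V) : (single F i₀ j₀ v).cy = 0 := rfl
@[simp] theorem array_single (i₀ j₀ : ℕ) (v : V) (i j : ℕ) :
    (single F i₀ j₀ v).array i j = if i = i₀ ∧ j = j₀ then v else 0 := rfl

variable [Module F V]

instance : Module F (ShiftAlgebra F V) :=
  inferInstanceAs (Module F (F × F × (ℕ → ℕ → V)))

@[simp] theorem cx_smul (r : F) (a : ShiftAlgebra F V) : (r • a).cx = r * a.cx := rfl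
@[simp] theorem cy_smul (r : F) (a : ShiftAlgebra F V) : (r • a).cy = r * a.cy := rfl
@[simp] theorem array_smul (r : F) (a : ShiftAlgebra F V) (i j : ℕ) :
    (r • a).array i j = r • a.array i j := rfl

instance : Bracket (ShiftAlgebra F V) (ShiftAlgebra F V) where
  bracket a b := of 0 0 fun i j =>
    a.cx • b.array (i + 1) j + a.cy • b.array i (j + 1)
      - (b.cx • a.array (i + 1) j + b.cy • a.array i (j + 1))

@[simp] theorem cx_lie (a b : ShiftAlgebra F V) : ⁅a, b⁆.cx = 0 := rfl
@[simp] theorem cy_lie (a b : ShiftAlgebra F V) : ⁅a, b⁆.cy = 0 := rfl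
@[simp] theorem array_lie (a b : ShiftAlgebra F V) (i j : ℕ) :
    ⁅a, b⁆.array i j = a.cx • b.array (i + 1) j + a.cy • b.array i (j + 1)
      - (b.cx • a.array (i + 1) j + b.cy • a.array i (j + 1)) := rfl

instance : LieRing (ShiftAlgebra F V) where
  add_lie a b c := by ext <;> simp; module
  lie_add a b c := by ext <;> simp; module
  lie_self a := by ext <;> simp
  leibniz_lie a b c := by ext <;> simp; module

instance : LieAlgebra F (ShiftAlgebra F V) where
  lie_smul r a b := by ext <;> simp; module

/-- Applying an `F`-linear automorphism of `V` to all entries of an array. -/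
def mapEquiv (e : V ≃ₗ[F] V) : ShiftAlgebra F V ≃ₗ⁅F⁆ ShiftAlgebra F V where
  toFun a := of a.cx a.cy fun i j => e (a.array i j)
  invFun a := of a.cx a.cy fun i j => e.symm (a.array i j)
  map_add' a b := by ext <;> simp
  map_smul' r a := by ext <;> simp
  map_lie' {a b} := by ext <;> simp
  left_inv a := by ext <;> simp
  right_inv a := by ext <;> simp

end ShiftAlgebra

/-! ### The nilpotent algebra attached to a matrix pair -/

/-- The noncommutative polynomials prescribing the entries of total degree `8` of an admissible
array; `topPoly j` belongs to the position `(8 - j, j)`.  The constants `1, 0, 1, 1` at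
`j = 5, 4, 3, 2` force an isomorphism to act on the two shifts by one common scalar. -/
noncomputable def topPoly (F : Type*) [Field F] : ℕ → FreeAlgebra F (Fin 2)
  | 0 => FreeAlgebra.ι F 1
  | 1 => FreeAlgebra.ι F 0
  | 2 => 1
  | 3 => 1
  | 4 => 0
  | 5 => 1
  | _ => 0

namespace MatrixPair

variable {F : Type*} [Field F]

@[simp] theorem eval_zero (p : MatrixPair F) : p.eval 0 = 0 := by simp [eval]
@[simp] theorem eval_one (p : MatrixPair F) : p.eval 1 = 1 := by simp [eval]
@[simp] theorem eval_topPoly_zero (p : MatrixPair F) : p.eval (topPoly F 0) = p.snd := by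
  simp [eval, topPoly]
@[simp] theorem eval_topPoly_one (p : MatrixPair F) : p.eval (topPoly F 1) = p.fst := by
  simp [eval, topPoly]
@[simp] theorem eval_topPoly_two (p : MatrixPair F) : p.eval (topPoly F 2) = 1 := by
  simp [topPoly]
@[simp] theorem eval_topPoly_three (p : MatrixPair F) : p.eval (topPoly F 3) = 1 := by
  simp [topPoly]
@[simp] theorem eval_topPoly_four (p : MatrixPair F) : p.eval (topPoly F 4) = 0 := by
  simp [topPoly]
@[simp] theorem eval_topPoly_five (p : MatrixPair F) : p.eval (topPoly F 5) = 1 := by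
  simp [topPoly]
theorem eval_topPoly_of_lt (p : MatrixPair F) {j : ℕ} (hj : 5 < j) :
    p.eval (topPoly F j) = 0 := by
  obtain ⟨k, rfl⟩ := Nat.exists_eq_add_of_lt hj
  rw [show 5 + k + 1 = k + 6 by omega]
  simp [topPoly]

/-- The Lie algebra `F² ⋉ M` of a matrix pair: `M` consists of the arrays supported on
`i + j ≤ 8`, `j ≤ 5` that are arbitrary in degrees `i + j < 8` and whose entries of degree `8` are
obtained from one vector, the entry at `(3, 5)`, by the matrices `p.eval (topPoly F j)`. -/
noncomputable def model (p : MatrixPair F) :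
    LieSubalgebra F (ShiftAlgebra F (Fin p.size → F)) where
  carrier := {a | (∀ i j, 8 < i + j ∨ 5 < j → a.array i j = 0) ∧
    ∀ i j, i + j = 8 → a.array i j = (p.eval (topPoly F j)).mulVec (a.array 3 5)}
  zero_mem' := by simp
  add_mem' {a b} ha hb := by
    refine ⟨fun i j h => ?_, fun i j h => ?_⟩
    · simp [ha.1 i j h, hb.1 i j h]
    · simp [ha.2 i j h, hb.2 i j h, Matrix.mulVec_add]
  smul_mem' r a ha := by
    refine ⟨fun i j h => ?_, fun i j h => ?_⟩
    · simp [ha.1 i j h]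
    · simp [ha.2 i j h, Matrix.mulVec_smul]
  lie_mem' {a b} ha hb := by
    have key : ∀ i j, 8 ≤ i + j ∨ 5 < j → ⁅a, b⁆.array i j = 0 := by
      intro i j h
      have h₁ : 8 < i + 1 + j ∨ 5 < j := by omega
      have h₂ : 8 < i + (j + 1) ∨ 5 < j + 1 := by omega
      simp [ha.1 _ _ h₁, ha.1 _ _ h₂, hb.1 _ _ h₁, hb.1 _ _ h₂]
    refine ⟨fun i j h => key i j (by omega), fun i j h => ?_⟩
    rw [key i j (by omega), key 3 5 (by omega), Matrix.mulVec_zero]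

theorem mem_model {p : MatrixPair F} {a : ShiftAlgebra F (Fin p.size → F)} :
    a ∈ p.model ↔ (∀ i j, 8 < i + j ∨ 5 < j → a.array i j = 0) ∧
      ∀ i j, i + j = 8 → a.array i j = (p.eval (topPoly F j)).mulVec (a.array 3 5) := Iff.rfl

/-- Similar matrix pairs have isomorphic algebras: `S⁻¹` is applied to all entries. -/
theorem Similar.nonempty_model_equiv {p q : MatrixPair F} (h : p.Similar q) :
    Nonempty (p.model ≃ₗ⁅F⁆ q.model) := by
  obtain ⟨n, A, B, S⟩ := h
  let p : MatrixPair F := ⟨n, A, B⟩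
  let q : MatrixPair F := ⟨n, (S⁻¹).val * A * S.val, (S⁻¹).val * B * S.val⟩
  have hS : S.val * (S⁻¹).val = 1 := by rw [← Units.val_mul]; simp
  have hS' : (S⁻¹).val * S.val = 1 := by rw [← Units.val_mul]; simp
  let e : (Fin n → F) ≃ₗ[F] (Fin n → F) :=
    LinearEquiv.ofLinearMap (Matrix.toLin' (S⁻¹).val) (Matrix.toLin' S.val)
      (by rw [← Matrix.toLin'_mul, hS', Matrix.toLin'_one])
      (by rw [← Matrix.toLin'_mul, hS, Matrix.toLin'_one])
  have conj : ∀ j, q.eval (topPoly F j) * (S⁻¹).val = (S⁻¹).val * p.eval (topPoly F j) := by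
    intro j
    match j with
    | 0 => simp [p, q, Matrix.mul_assoc]
    | 1 => simp [p, q, Matrix.mul_assoc]
    | 2 => simp [p, q]
    | 3 => simp [p, q]
    | 4 => simp [p, q]
    | 5 => simp [p, q]
    | j + 6 => simp [eval_topPoly_of_lt]
  have fwd : ∀ a ∈ p.model, ShiftAlgebra.mapEquiv e a ∈ q.model := by
    intro a ha
    refine mem_model.2 ⟨fun i j h => ?_, fun i j h => ?_⟩
    · change e _ = 0
      rw [ha.1 i j h, map_zero]
    · change (S⁻¹).val.mulVec _ = Matrix.mulVec _ ((S⁻¹).val.mulVec _)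
      rw [Matrix.mulVec_mulVec, conj, ← Matrix.mulVec_mulVec, ha.2 i j h]
  have bwd : ∀ a ∈ q.model, (ShiftAlgebra.mapEquiv e).symm a ∈ p.model := by
    intro a ha
    refine mem_model.2 ⟨fun i j h => ?_, fun i j h => ?_⟩
    · change e.symm _ = 0
      rw [ha.1 i j h, map_zero]
    · have conj' : S.val * q.eval (topPoly F j) = p.eval (topPoly F j) * S.val := by
        have := congrArg (fun M => S.val * M * S.val) (conj j)
        simpa [Matrix.mul_assoc, hS', ← Matrix.mul_assoc S.val (S⁻¹).val, hS] using this
      change S.val.mulVec _ = Matrix.mulVec _ (S.val.mulVec _)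
      rw [Matrix.mulVec_mulVec, ← conj', ← Matrix.mulVec_mulVec, ha.2 i j h]
  exact ⟨LieEquiv.ofSubalgebras _ _ (ShiftAlgebra.mapEquiv e) (by
    ext b
    constructor
    · rintro ⟨a, ha, rfl⟩
      exact fwd a ha
    · intro hb
      exact ⟨_, bwd b hb, (ShiftAlgebra.mapEquiv e).apply_symm_apply b⟩)⟩

end MatrixPair

/-! ### Isomorphisms between the algebras of matrix pairs -/

namespace ShiftAlgebra

variable {F V : Type*} [Field F] [AddCommGroup V] [Module F V]

theorem lie_single_zero_right (a : ShiftAlgebra F V) (i : ℕ) (v : V) :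
    ⁅a, single F (i + 1) 0 v⁆ = a.cx • single F i 0 v := by
  ext <;> simp

theorem lie_single_zero_left (a : ShiftAlgebra F V) (j : ℕ) (v : V) :
    ⁅a, single F 0 (j + 1) v⁆ = a.cy • single F 0 j v := by
  ext <;> simp

end ShiftAlgebra

namespace LieEquiv

variable {F L L' : Type*} [Field F] [LieRing L] [LieAlgebra F L] [LieRing L'] [LieAlgebra F L']

theorem map_ad_pow (φ : L ≃ₗ⁅F⁆ L') (a b : L) (k : ℕ) :
    φ ((LieAlgebra.ad F L a ^ k) b) = (LieAlgebra.ad F L' (φ a) ^ k) (φ b) := by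
  induction k with
  | zero => simp
  | succ k ih =>
    rw [pow_succ', pow_succ', Module.End.mul_apply, Module.End.mul_apply, LieAlgebra.ad_apply, LieAlgebra.ad_apply,
      LieEquiv.map_lie, ih]

theorem ad_pow_eq_zero (φ : L ≃ₗ⁅F⁆ L') {a : L} {k : ℕ} (h : LieAlgebra.ad F L a ^ k = 0) :
    LieAlgebra.ad F L' (φ a) ^ k = 0 := by
  refine LinearMap.ext fun b => ?_
  rw [← φ.apply_symm_apply b, ← φ.map_ad_pow, h]
  simp

theorem ad_pow_eq_zero_iff (φ : L ≃ₗ⁅F⁆ L') {a : L} {k : ℕ} :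
    LieAlgebra.ad F L' (φ a) ^ k = 0 ↔ LieAlgebra.ad F L a ^ k = 0 := by
  refine ⟨fun h => ?_, φ.ad_pow_eq_zero⟩
  have := φ.symm.ad_pow_eq_zero h
  rwa [φ.symm_apply_apply] at this

end LieEquiv

namespace MatrixPair

open ShiftAlgebra LieAlgebra

variable {F : Type*} [Field F] {p q : MatrixPair F}

theorem single_mem_model {i j : ℕ} (hij : i + j ≤ 7) (hj : j ≤ 5) (v : Fin p.size → F) :
    single F i j v ∈ p.model := by
  refine mem_model.2 ⟨fun i' j' h => ?_, fun i' j' h => ?_⟩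
  · rw [array_single, if_neg (by omega)]
  · rw [array_single, array_single, if_neg (by omega), if_neg (by omega), Matrix.mulVec_zero]

/-- Each bracket with a fixed element lowers the degree of an array by one. -/
theorem array_ad_pow_of_degree (a b : p.model) (k : ℕ) :
    ((ad F p.model a ^ (k + 1)) b).1.cx = 0 ∧ ((ad F p.model a ^ (k + 1)) b).1.cy = 0 ∧
      ∀ i j, 8 ≤ i + j + k → ((ad F p.model a ^ (k + 1)) b).1.array i j = 0 := by
  induction k with
  | zero =>
    refine ⟨by simp, by simp, fun i j h => ?_⟩
    have h₁ : 8 < i + 1 + j ∨ 5 < j := by omega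
    have h₂ : 8 < i + (j + 1) ∨ 5 < j + 1 := by omega
    simp [a.2.1 _ _ h₁, a.2.1 _ _ h₂, b.2.1 _ _ h₁, b.2.1 _ _ h₂]
  | succ k ih =>
    obtain ⟨h₁, h₂, h₃⟩ := ih
    rw [pow_succ', Module.End.mul_apply, ad_apply]
    refine ⟨by simp, by simp, fun i j h => ?_⟩
    rw [LieSubalgebra.coe_bracket, array_lie, h₁, h₂, h₃ _ _ (by omega), h₃ _ _ (by omega)]
    simp

theorem isNilpotent_model [FiniteDimensional F p.model] : LieRing.IsNilpotent p.model := by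
  rw [LieAlgebra.isNilpotent_iff_forall (R := F)]
  refine fun a => ⟨9, LinearMap.ext fun b => ?_⟩
  obtain ⟨h₁, h₂, h₃⟩ := array_ad_pow_of_degree a b 8
  exact Subtype.ext (ShiftAlgebra.ext h₁ h₂ fun i j => h₃ i j (by omega))

/-- Modulo arrays such an element is a multiple of `∂/∂y`, and arrays have only six rows. -/
theorem ad_pow_seven_eq_zero {a : p.model} (ha : a.1.cx = 0) : ad F p.model a ^ 7 = 0 := by
  have key : ∀ (b : p.model) (k : ℕ),
      ((ad F p.model a ^ (k + 1)) b).1.cx = 0 ∧ ((ad F p.model a ^ (k + 1)) b).1.cy = 0 ∧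
        ∀ i j, 5 < j + k → ((ad F p.model a ^ (k + 1)) b).1.array i j = 0 := by
    intro b k
    induction k with
    | zero =>
      refine ⟨by simp, by simp, fun i j h => ?_⟩
      have h₁ : 8 < i + 1 + j ∨ 5 < j := by omega
      have h₂ : 8 < i + (j + 1) ∨ 5 < j + 1 := by omega
      simp [a.2.1 _ _ h₁, a.2.1 _ _ h₂, b.2.1 _ _ h₁, b.2.1 _ _ h₂]
    | succ k ih =>
      obtain ⟨h₁, h₂, h₃⟩ := ih
      rw [pow_succ', Module.End.mul_apply, ad_apply]
      refine ⟨by simp, by simp, fun i j h => ?_⟩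
      rw [LieSubalgebra.coe_bracket, array_lie, h₁, h₂, h₃ i (j + 1) (by omega), ha]
      simp
  refine LinearMap.ext fun b => ?_
  obtain ⟨h₁, h₂, h₃⟩ := key b 6
  exact Subtype.ext (ShiftAlgebra.ext h₁ h₂ fun i j => h₃ i j (by omega))

theorem ad_pow_two_eq_zero {a : p.model} (ha : a.1.cx = 0) (ha' : a.1.cy = 0) :
    ad F p.model a ^ 2 = 0 := by
  refine LinearMap.ext fun b => Subtype.ext (ShiftAlgebra.ext ?_ ?_ fun i j => ?_) <;>
    simp [pow_two, ha, ha']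

theorem ad_pow_single_zero_right (a : p.model) {k : ℕ} (hk : k ≤ 7) (v : Fin p.size → F) :
    ((ad F p.model a ^ k) ⟨single F k 0 v, single_mem_model (by omega) (by omega) v⟩).1 =
      a.1.cx ^ k • single F 0 0 v := by
  induction k with
  | zero => simp
  | succ k ih =>
    have h : ad F p.model a
        ⟨single F (k + 1) 0 v, single_mem_model (by omega) (by omega) v⟩ =
        a.1.cx • ⟨single F k 0 v, single_mem_model (by omega) (by omega) v⟩ :=
      Subtype.ext (lie_single_zero_right a.1 k v)
    rw [pow_succ, Module.End.mul_apply, h, map_smul, SetLike.val_smul, ih (by omega),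
      smul_smul, pow_succ']

theorem ad_pow_single_zero_left (a : p.model) {k : ℕ} (hk : k ≤ 5) (v : Fin p.size → F) :
    ((ad F p.model a ^ k) ⟨single F 0 k v, single_mem_model (by omega) (by omega) v⟩).1 =
      a.1.cy ^ k • single F 0 0 v := by
  induction k with
  | zero => simp
  | succ k ih =>
    have h : ad F p.model a
        ⟨single F 0 (k + 1) v, single_mem_model (by omega) (by omega) v⟩ =
        a.1.cy • ⟨single F 0 k v, single_mem_model (by omega) (by omega) v⟩ :=
      Subtype.ext (lie_single_zero_left a.1 k v)
    rw [pow_succ, Module.End.mul_apply, h, map_smul, SetLike.val_smul, ih (by omega),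
      smul_smul, pow_succ']

theorem cx_eq_zero_of_ad_pow (hp : 0 < p.size) {a : p.model} {k : ℕ} (hk : k ≤ 7)
    (h : ad F p.model a ^ k = 0) : a.1.cx = 0 := by
  have h₁ := ad_pow_single_zero_right a hk (fun _ => 1)
  rw [h] at h₁
  have h₂ := congrArg (fun b => b.array 0 0 ⟨0, hp⟩) h₁.symm
  simp only [array_smul, array_single, and_self, if_true, Pi.smul_apply, smul_eq_mul, mul_one] at h₂
  exact (pow_eq_zero_iff (M₀ := F) (n := k) (by rintro rfl; simp at h₂)).1 h₂

theorem cy_eq_zero_of_ad_pow (hp : 0 < p.size) {a : p.model} {k : ℕ} (hk : k ≤ 5)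
    (h : ad F p.model a ^ k = 0) : a.1.cy = 0 := by
  have h₁ := ad_pow_single_zero_left a hk (fun _ => 1)
  rw [h] at h₁
  have h₂ := congrArg (fun b => b.array 0 0 ⟨0, hp⟩) h₁.symm
  simp only [array_smul, array_single, and_self, if_true, Pi.smul_apply, smul_eq_mul, mul_one] at h₂
  exact (pow_eq_zero_iff (M₀ := F) (n := k) (by rintro rfl; simp at h₂)).1 h₂

/-- The element `∂/∂x` of the algebra of a matrix pair. -/
noncomputable def shiftX (p : MatrixPair F) : p.model :=
  ⟨of 1 0 0, mem_model.2 ⟨fun _ _ _ => rfl, fun _ _ _ => (Matrix.mulVec_zero _).symm⟩⟩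

/-- The element `∂/∂y` of the algebra of a matrix pair. -/
noncomputable def shiftY (p : MatrixPair F) : p.model :=
  ⟨of 0 1 0, mem_model.2 ⟨fun _ _ _ => rfl, fun _ _ _ => (Matrix.mulVec_zero _).symm⟩⟩

/-- The constant array `v`. -/
noncomputable def const (p : MatrixPair F) (v : Fin p.size → F) : p.model :=
  ⟨single F 0 0 v, single_mem_model (by omega) (by omega) v⟩

/-- The homogeneous array of degree `8` with entry `v` at `(3, 5)`. -/
noncomputable def topArray (p : MatrixPair F) (v : Fin p.size → F) : p.model :=
  ⟨of 0 0 fun i j => if i + j = 8 then (p.eval (topPoly F j)).mulVec v else 0, by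
    refine mem_model.2 ⟨fun i j h => ?_, fun i j h => by simp [h]⟩
    rw [array_of]
    split_ifs with h'
    · rw [eval_topPoly_of_lt p (by omega), Matrix.zero_mulVec]
    · rfl⟩

@[simp] theorem array_lie_shiftX (f : p.model) (i j : ℕ) :
    ⁅p.shiftX, f⁆.1.array i j = f.1.array (i + 1) j := by
  simp [shiftX]

@[simp] theorem array_lie_shiftY (f : p.model) (i j : ℕ) :
    ⁅p.shiftY, f⁆.1.array i j = f.1.array i (j + 1) := by
  simp [shiftY]

theorem lie_shiftX_const (v : Fin p.size → F) : ⁅p.shiftX, p.const v⁆ = 0 :=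
  Subtype.ext (by ext <;> simp [shiftX, const])

theorem lie_shiftY_const (v : Fin p.size → F) : ⁅p.shiftY, p.const v⁆ = 0 :=
  Subtype.ext (by ext <;> simp [shiftY, const])

theorem array_ad_shiftX_pow (f : p.model) (k i j : ℕ) :
    ((ad F p.model p.shiftX ^ k) f).1.array i j = f.1.array (i + k) j := by
  induction k generalizing i with
  | zero => simp
  | succ k ih =>
    rw [pow_succ', Module.End.mul_apply, ad_apply, array_lie_shiftX, ih]
    congr 1; omega

theorem array_ad_shiftY_pow (f : p.model) (k i j : ℕ) :
    ((ad F p.model p.shiftY ^ k) f).1.array i j = f.1.array i (j + k) := by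
  induction k generalizing j with
  | zero => simp
  | succ k ih =>
    rw [pow_succ', Module.End.mul_apply, ad_apply, array_lie_shiftY, ih]
    congr 1; omega

theorem cx_ad_pow (a f : p.model) (hf : f.1.cx = 0) (k : ℕ) :
    ((ad F p.model a ^ k) f).1.cx = 0 := by
  cases k with
  | zero => exact hf
  | succ k => exact (array_ad_pow_of_degree a f k).1

theorem cy_ad_pow (a f : p.model) (hf : f.1.cy = 0) (k : ℕ) :
    ((ad F p.model a ^ k) f).1.cy = 0 := by
  cases k with
  | zero => exact hf
  | succ k => exact (array_ad_pow_of_degree a f k).2.1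

/-- The derivatives of order `8` of `topArray v` are the constants `p.eval (topPoly F j) v`. -/
theorem ad_pow_topArray (v : Fin p.size → F) {i j : ℕ} (h : i + j = 8) :
    (ad F p.model p.shiftX ^ i) ((ad F p.model p.shiftY ^ j) (p.topArray v)) =
      p.const ((p.eval (topPoly F j)).mulVec v) := by
  refine Subtype.ext (ShiftAlgebra.ext ?_ ?_ fun i' j' => ?_)
  · exact cx_ad_pow _ _ (cx_ad_pow _ _ rfl _) _
  · exact cy_ad_pow _ _ (cy_ad_pow _ _ rfl _) _
  · rw [array_ad_shiftX_pow, array_ad_shiftY_pow]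
    simp only [topArray, const, array_of, array_single]
    by_cases h' : i' = 0 ∧ j' = 0
    · obtain ⟨rfl, rfl⟩ := h'
      simp [h]
    · rw [if_neg (by omega), if_neg h']

/-- An isomorphism of Lie algebras preserves the arrays, which are the elements `a` with
`(ad a) ^ 2 = 0`, and the span of `∂/∂y` and the arrays, which consists of the elements `a` with
`(ad a) ^ 7 = 0`.  It therefore induces on the constant arrays, that is on the arrays killed by
both shifts, an injective linear map that intertwines the two matrix pairs. -/
theorem exists_intertwiner [CharZero F] (hp : 0 < p.size) (φ : p.model ≃ₗ⁅F⁆ q.model) :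
    ∃ S : (Fin p.size → F) →ₗ[F] (Fin q.size → F), Function.Injective S ∧
      (∀ v, S (p.fst.mulVec v) = q.fst.mulVec (S v)) ∧
      ∀ v, S (p.snd.mulVec v) = q.snd.mulVec (S v) := by
  have hX : ¬ ad F p.model p.shiftX ^ 7 = 0 := fun h =>
    one_ne_zero (α := F) (cx_eq_zero_of_ad_pow hp le_rfl h)
  have hY : ¬ ad F p.model p.shiftY ^ 2 = 0 := fun h =>
    one_ne_zero (α := F) (cy_eq_zero_of_ad_pow hp (by omega) h)
  have hq : 0 < q.size := by
    by_contra h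
    refine hX (φ.ad_pow_eq_zero_iff.1 (LinearMap.ext fun b => ?_))
    obtain ⟨h₁, h₂, -⟩ := array_ad_pow_of_degree (φ p.shiftX) b 6
    exact Subtype.ext (ShiftAlgebra.ext h₁ h₂ fun i j => funext fun k => absurd k.pos h)
  have hYx : (φ p.shiftY).1.cx = 0 := cx_eq_zero_of_ad_pow hq le_rfl
    (φ.ad_pow_eq_zero (ad_pow_seven_eq_zero rfl))
  have ha : (φ p.shiftX).1.cx ≠ 0 := fun h =>
    hX (φ.ad_pow_eq_zero_iff.1 (ad_pow_seven_eq_zero h))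
  have hb : (φ p.shiftY).1.cy ≠ 0 := fun h =>
    hY (φ.ad_pow_eq_zero_iff.1 (ad_pow_two_eq_zero hYx h))
  -- Up to arrays, `φ` maps `∂/∂x` to `a ∂/∂x + c ∂/∂y` and `∂/∂y` to `b ∂/∂y`.
  set a := (φ p.shiftX).1.cx
  set b := (φ p.shiftY).1.cy
  set c := (φ p.shiftX).1.cy
  have harr : ∀ f : p.model, f.1.cx = 0 → f.1.cy = 0 →
      (φ f).1.cx = 0 ∧ (φ f).1.cy = 0 := by
    intro f h₁ h₂
    have h := φ.ad_pow_eq_zero (ad_pow_two_eq_zero h₁ h₂)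
    exact ⟨cx_eq_zero_of_ad_pow hq (by omega) h, cy_eq_zero_of_ad_pow hq (by omega) h⟩
  have hx : ∀ f : p.model, f.1.cx = 0 → f.1.cy = 0 → ∀ i j,
      (φ ⁅p.shiftX, f⁆).1.array i j =
        a • (φ f).1.array (i + 1) j + c • (φ f).1.array i (j + 1) := by
    intro f h₁ h₂ i j
    rw [LieEquiv.map_lie, LieSubalgebra.coe_bracket, array_lie, (harr f h₁ h₂).1,
      (harr f h₁ h₂).2]
    simp [a, c]
  have hy : ∀ f : p.model, f.1.cx = 0 → f.1.cy = 0 → ∀ i j,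
      (φ ⁅p.shiftY, f⁆).1.array i j = b • (φ f).1.array i (j + 1) := by
    intro f h₁ h₂ i j
    rw [LieEquiv.map_lie, LieSubalgebra.coe_bracket, array_lie, (harr f h₁ h₂).1,
      (harr f h₁ h₂).2]
    simp [b, hYx]
  have hyk : ∀ f : p.model, f.1.cx = 0 → f.1.cy = 0 → ∀ k i j,
      (φ ((ad F p.model p.shiftY ^ k) f)).1.array i j = b ^ k • (φ f).1.array i (j + k) := by
    intro f h₁ h₂ k
    induction k with
    | zero => simp
    | succ k ih =>
      intro i j
      rw [pow_succ', Module.End.mul_apply, ad_apply,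
        hy _ (cx_ad_pow _ _ h₁ _) (cy_ad_pow _ _ h₂ _), ih, smul_smul, pow_succ',
        show j + (k + 1) = j + 1 + k by omega]
  let S : (Fin p.size → F) →ₗ[F] (Fin q.size → F) :=
    { toFun := fun v => (φ (p.const v)).1.array 0 0
      map_add' := fun v w => by
        have : p.const (v + w) = p.const v + p.const w :=
          Subtype.ext (by ext i j <;> simp [const]; split_ifs <;> simp)
        rw [this, map_add]; rfl
      map_smul' := fun r v => by
        have : p.const (r • v) = r • p.const v :=
          Subtype.ext (by ext i j <;> simp [const]; split_ifs <;> simp)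
        rw [this, map_smul]; rfl }
  have hS : Function.Injective S := by
    refine (injective_iff_map_eq_zero S).2 fun v hv => ?_
    have h₁ : ∀ i j, (φ (p.const v)).1.array i (j + 1) = 0 := fun i j => by
      have := hy (p.const v) rfl rfl i j
      rw [lie_shiftY_const, map_zero] at this
      exact (smul_eq_zero.1 this.symm).resolve_left hb
    have h₂ : ∀ i j, (φ (p.const v)).1.array (i + 1) j = 0 := fun i j => by
      have := hx (p.const v) rfl rfl i j
      rw [lie_shiftX_const, map_zero, h₁, smul_zero, add_zero] at this
      exact (smul_eq_zero.1 this.symm).resolve_left ha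
    have h₃ : φ (p.const v) = 0 := by
      refine Subtype.ext (ShiftAlgebra.ext (harr _ rfl rfl).1 (harr _ rfl rfl).2 fun i j => ?_)
      match i, j with
      | 0, 0 => exact hv
      | i + 1, j => exact h₂ i j
      | i, j + 1 => exact h₁ i j
    have h₄ : p.const v = 0 := by simpa using congrArg φ.symm h₃
    have h₅ := congrArg (fun f : p.model => f.1.array 0 0) h₄
    simpa [const] using h₅
  -- The image of `topArray v` has the entry `w v` at `(3, 5)`.
  let w : (Fin p.size → F) → (Fin q.size → F) := fun v => (φ (p.topArray v)).1.array 3 5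
  have hw : ∀ v i j, i + j = 8 →
      (φ (p.topArray v)).1.array i j = (q.eval (topPoly F j)).mulVec (w v) :=
    fun v i j h => (φ (p.topArray v)).2.2 i j h
  have hzero : ∀ v i j, 5 < j → (φ (p.topArray v)).1.array i j = 0 :=
    fun v i j h => (φ (p.topArray v)).2.1 i j (Or.inr h)
  have hS_eq : ∀ v i j, i + j = 8 → S ((p.eval (topPoly F j)).mulVec v) =
      (φ ((ad F p.model p.shiftX ^ i)
        ((ad F p.model p.shiftY ^ j) (p.topArray v)))).1.array 0 0 := by
    intro v i j h
    rw [ad_pow_topArray v h]; rfl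
  -- The binomial expansion of `(a ∂/∂x + c ∂/∂y) ^ (k + 1)` on arrays with two nonzero rows.
  have hxk : ∀ f : p.model, f.1.cx = 0 → f.1.cy = 0 → (∀ i j, (φ f).1.array i (j + 2) = 0) →
      ∀ k i, (∀ j, (φ ((ad F p.model p.shiftX ^ (k + 1)) f)).1.array i (j + 2) = 0) ∧
        (φ ((ad F p.model p.shiftX ^ (k + 1)) f)).1.array i 1 =
          a ^ (k + 1) • (φ f).1.array (i + k + 1) 1 ∧
        (φ ((ad F p.model p.shiftX ^ (k + 1)) f)).1.array i 0 =
          a ^ (k + 1) • (φ f).1.array (i + k + 1) 0 +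
            ((k + 1) * a ^ k * c) • (φ f).1.array (i + k) 1 := by
    intro f h₁ h₂ hf k
    induction k with
    | zero =>
      intro i
      rw [zero_add, pow_one, ad_apply]
      refine ⟨fun j => ?_, ?_, ?_⟩
      · rw [hx f h₁ h₂, hf, hf i (j + 1)]; simp
      · rw [hx f h₁ h₂, hf]; simp
      · rw [hx f h₁ h₂]; simp
    | succ k ih =>
      intro i
      rw [pow_succ' _ (k + 1), Module.End.mul_apply, ad_apply]
      have hx' := hx _ (cx_ad_pow p.shiftX f h₁ (k + 1)) (cy_ad_pow p.shiftX f h₂ (k + 1))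
      refine ⟨fun j => ?_, ?_, ?_⟩
      · rw [hx', (ih _).1, (ih _).1 (j + 1)]; simp
      · rw [hx', (ih _).2.1, (ih _).1 0, smul_zero, add_zero, smul_smul, ← pow_succ',
          show i + 1 + k + 1 = i + (k + 1) + 1 by omega]
      · rw [hx', (ih _).2.2, zero_add, (ih _).2.1, show i + 1 + k + 1 = i + (k + 1) + 1 by omega,
          show i + 1 + k = i + (k + 1) by omega, show i + k + 1 = i + (k + 1) by omega]
        push_cast
        module
  have hw₅ : ∀ v, S v = (a ^ 3 * b ^ 5) • w v := by
    intro v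
    have h := hS_eq v 3 5 rfl
    rw [eval_topPoly_five, Matrix.one_mulVec, (hxk _ (cx_ad_pow _ _ rfl _) (cy_ad_pow _ _ rfl _)
      (fun i j => by rw [hyk _ rfl rfl, hzero _ _ _ (by omega), smul_zero]) 2 0).2.2,
      hyk _ rfl rfl, hyk _ rfl rfl, hzero v _ (1 + 5) (by omega), smul_zero, smul_zero, add_zero,
      smul_smul] at h
    exact h
  have hw_ne : ∀ v, v ≠ 0 → w v ≠ 0 := fun v hv h => hv (hS (by rw [hw₅, h, smul_zero, map_zero]))
  obtain ⟨v₀, hv₀⟩ : ∃ v : Fin p.size → F, v ≠ 0 :=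
    ⟨fun _ => 1, fun h => one_ne_zero (congrFun h ⟨0, hp⟩)⟩
  -- The entry `0` at `(4, 4)` excludes a shear.
  have hc : c = 0 := by
    have h := hS_eq v₀ 4 4 rfl
    rw [eval_topPoly_four, Matrix.zero_mulVec, map_zero,
      (hxk _ (cx_ad_pow _ _ rfl _) (cy_ad_pow _ _ rfl _)
      (fun i j => by rw [hyk _ rfl rfl, hzero _ _ _ (by omega), smul_zero]) 3 0).2.2,
      hyk _ rfl rfl, hyk _ rfl rfl, hw v₀ (0 + 3 + 1) _ rfl, zero_add 4, eval_topPoly_four,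
      Matrix.zero_mulVec, smul_zero, smul_zero, zero_add, smul_smul] at h
    have h' := (smul_eq_zero.1 h.symm).resolve_right (hw_ne v₀ hv₀)
    have h₄ : ((3 : ℕ) + 1 : F) ≠ 0 := Nat.cast_add_one_ne_zero 3
    exact (mul_eq_zero.1 ((mul_eq_zero.1 h').resolve_right (pow_ne_zero _ hb))).resolve_left
      (mul_ne_zero h₄ (pow_ne_zero _ ha))
  have hxk' : ∀ f : p.model, f.1.cx = 0 → f.1.cy = 0 → ∀ k i j,
      (φ ((ad F p.model p.shiftX ^ k) f)).1.array i j = a ^ k • (φ f).1.array (i + k) j := by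
    intro f h₁ h₂ k
    induction k with
    | zero => simp
    | succ k ih =>
      intro i j
      rw [pow_succ', Module.End.mul_apply, ad_apply,
        hx _ (cx_ad_pow _ _ h₁ _) (cy_ad_pow _ _ h₂ _), ih, hc, zero_smul, add_zero, smul_smul,
        pow_succ', show i + (k + 1) = i + 1 + k by omega]
  have hS_w : ∀ v i j, i + j = 8 → S ((p.eval (topPoly F j)).mulVec v) =
      (a ^ i * b ^ j) • (q.eval (topPoly F j)).mulVec (w v) := by
    intro v i j h
    rw [hS_eq v i j h, hxk' _ (cx_ad_pow _ _ rfl _) (cy_ad_pow _ _ rfl _), hyk _ rfl rfl,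
      hw v _ _ (by omega), smul_smul, zero_add j]
  -- The three entries `1` exclude a nontrivial torus element.
  have hab : a = b := by
    have h₃ := hS_w v₀ 5 3 rfl
    have h₂ := hS_w v₀ 6 2 rfl
    rw [eval_topPoly_three, eval_topPoly_three, Matrix.one_mulVec, Matrix.one_mulVec, hw₅] at h₃
    rw [eval_topPoly_two, eval_topPoly_two, Matrix.one_mulVec, Matrix.one_mulVec, hw₅] at h₂
    have h₃' := smul_left_injective F (hw_ne v₀ hv₀) h₃
    have h₂' := smul_left_injective F (hw_ne v₀ hv₀) h₂
    have e : a ^ 5 * b ^ 2 * b = a ^ 5 * b ^ 2 * a := by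
      linear_combination h₂' - h₃'
    exact (mul_left_cancel₀ (by positivity) e).symm
  have hS_w' : ∀ v, S v = a ^ 8 • w v := fun v => by rw [hw₅, ← hab, ← pow_add]
  refine ⟨S, hS, fun v => ?_, fun v => ?_⟩
  · have h := hS_w v 7 1 rfl
    rwa [eval_topPoly_one, eval_topPoly_one, ← hab, ← pow_add, ← Matrix.mulVec_smul,
      ← hS_w'] at h
  · have h := hS_w v 8 0 rfl
    rwa [eval_topPoly_zero, eval_topPoly_zero, ← hab, ← pow_add, ← Matrix.mulVec_smul,
      ← hS_w'] at h

/-- The size of a pair is recovered from the isomorphism as well, since the intertwiners of an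
isomorphism and of its inverse are injective. -/
theorem similar_of_model_equiv [CharZero F] (φ : p.model ≃ₗ⁅F⁆ q.model) : p.Similar q := by
  have le : ∀ {p q : MatrixPair F}, (p.model ≃ₗ⁅F⁆ q.model) → p.size ≤ q.size := by
    intro p q φ
    rcases Nat.eq_zero_or_pos p.size with h | h
    · omega
    · obtain ⟨S, hS, -⟩ := exists_intertwiner h φ
      simpa using LinearMap.finrank_le_finrank_of_injective hS
  have hsize := le_antisymm (le φ) (le φ.symm)
  obtain ⟨n, A, B⟩ := p
  obtain ⟨m, C, D⟩ := q
  obtain rfl : n = m := hsize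
  obtain ⟨S, hS, h₁, h₂⟩ : ∃ S : (Fin n → F) →ₗ[F] (Fin n → F), Function.Injective S ∧
      (∀ v, S (A.mulVec v) = C.mulVec (S v)) ∧ ∀ v, S (B.mulVec v) = D.mulVec (S v) := by
    rcases Nat.eq_zero_or_pos n with rfl | hn
    · exact ⟨0, Function.injective_of_subsingleton _, fun _ => Subsingleton.elim _ _,
        fun _ => Subsingleton.elim _ _⟩
    · exact exists_intertwiner hn φ
  have hM : IsUnit (LinearMap.toMatrix' S) := by
    rw [← Matrix.mulVec_injective_iff_isUnit]
    simpa [Function.Injective, LinearMap.toMatrix'_mulVec] using hS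
  obtain ⟨T, hT⟩ := hM
  have conj : ∀ M N : Matrix (Fin n) (Fin n) F, (∀ v, S (M.mulVec v) = N.mulVec (S v)) →
      N = T.val * M * (T⁻¹).val := by
    intro M N h
    have hTM : T.val * M = N * T.val := by
      refine Matrix.mulVec_injective (funext fun v => ?_)
      simpa [hT, ← Matrix.mulVec_mulVec, LinearMap.toMatrix'_mulVec] using h v
    rw [hTM, Matrix.mul_assoc, ← Units.val_mul, mul_inv_cancel, Units.val_one, Matrix.mul_one]
  rw [conj A C h₁, conj B D h₂]
  simpa using Similar.conj n A B T⁻¹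

end MatrixPair

/-! ### Realization by vector fields in four variables -/

open MvPolynomial

section Realization

variable (F : Type*) [Field F]

/-- The exponent of the monomial `x ^ i * y ^ j * z ^ k`. -/
noncomputable def xyzExponent (i j k : ℕ) : Fin 4 →₀ ℕ :=
  Finsupp.single 0 i + Finsupp.single 1 j + Finsupp.single 2 k

theorem xyzExponent_inj {i j k i' j' k' : ℕ} :
    xyzExponent i j k = xyzExponent i' j' k' ↔ i = i' ∧ j = j' ∧ k = k' := by
  refine ⟨fun h => ?_, by rintro ⟨rfl, rfl, rfl⟩; rfl⟩
  have h₀ := DFunLike.congr_fun h 0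
  have h₁ := DFunLike.congr_fun h 1
  have h₂ := DFunLike.congr_fun h 2
  simp [xyzExponent] at h₀ h₁ h₂
  exact ⟨h₀, h₁, h₂⟩

/-- The polynomial `x ^ i / i! * y ^ j / j! * z ^ k`. -/
noncomputable def xyzMonomial (i j k : ℕ) : MvPolynomial (Fin 4) F :=
  monomial (xyzExponent i j k) ((i.factorial * j.factorial : F)⁻¹)

theorem pderiv_x_xyzMonomial_zero (j k : ℕ) : pderiv 0 (xyzMonomial F 0 j k) = 0 := by
  simp [xyzMonomial, xyzExponent, pderiv_monomial]

theorem pderiv_y_xyzMonomial_zero (i k : ℕ) : pderiv 1 (xyzMonomial F i 0 k) = 0 := by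
  simp [xyzMonomial, xyzExponent, pderiv_monomial]

theorem pderiv_t_xyzMonomial (i j k : ℕ) : pderiv 3 (xyzMonomial F i j k) = 0 := by
  simp [xyzMonomial, xyzExponent, pderiv_monomial]

theorem pderiv_x_xyzMonomial_succ [CharZero F] (i j k : ℕ) :
    pderiv 0 (xyzMonomial F (i + 1) j k) = xyzMonomial F i j k := by
  have he : xyzExponent (i + 1) j k - Finsupp.single 0 1 = xyzExponent i j k := by
    ext s; fin_cases s <;> simp [xyzExponent]
  have h₁ : (i + 1 : F) ≠ 0 := Nat.cast_add_one_ne_zero i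
  rw [xyzMonomial, pderiv_monomial, he, xyzMonomial]
  congr 1
  simp [xyzExponent, Nat.factorial_succ]
  field_simp

theorem pderiv_y_xyzMonomial_succ [CharZero F] (i j k : ℕ) :
    pderiv 1 (xyzMonomial F i (j + 1) k) = xyzMonomial F i j k := by
  have he : xyzExponent i (j + 1) k - Finsupp.single 1 1 = xyzExponent i j k := by
    ext s; fin_cases s <;> simp [xyzExponent]
  have h₁ : (j + 1 : F) ≠ 0 := Nat.cast_add_one_ne_zero j
  rw [xyzMonomial, pderiv_monomial, he, xyzMonomial]
  congr 1
  simp [xyzExponent, Nat.factorial_succ]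
  field_simp

variable {F} {n : ℕ}

/-- The polynomial with Taylor coefficients `f i j`, where `i ≤ 8` and `j ≤ 5`; the `k`-th
coordinate of `F ^ n` is represented by `z ^ k`. -/
noncomputable def arrayPoly (f : ℕ → ℕ → Fin n → F) : MvPolynomial (Fin 4) F :=
  ∑ i ∈ Finset.range 9, ∑ j ∈ Finset.range 6, ∑ k, f i j k • xyzMonomial F i j k

theorem arrayPoly_add (f g : ℕ → ℕ → Fin n → F) :
    arrayPoly (fun i j => f i j + g i j) = arrayPoly f + arrayPoly g := by
  simp [arrayPoly, add_smul, Finset.sum_add_distrib]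

theorem arrayPoly_smul (r : F) (f : ℕ → ℕ → Fin n → F) :
    arrayPoly (fun i j => r • f i j) = r • arrayPoly f := by
  simp [arrayPoly, Finset.smul_sum, mul_smul]

theorem arrayPoly_sub (f g : ℕ → ℕ → Fin n → F) :
    arrayPoly (fun i j => f i j - g i j) = arrayPoly f - arrayPoly g := by
  simp [arrayPoly, sub_smul, Finset.sum_sub_distrib]

theorem pderiv_x_arrayPoly [CharZero F] {f : ℕ → ℕ → Fin n → F} (hf : ∀ j, f 9 j = 0) :
    pderiv 0 (arrayPoly f) = arrayPoly fun i j => f (i + 1) j := by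
  simp only [arrayPoly, map_sum, Derivation.map_smul]
  rw [Finset.sum_range_succ', Finset.sum_range_succ _ 8]
  simp [pderiv_x_xyzMonomial_zero, pderiv_x_xyzMonomial_succ, hf]

theorem pderiv_y_arrayPoly [CharZero F] {f : ℕ → ℕ → Fin n → F} (hf : ∀ i, f i 6 = 0) :
    pderiv 1 (arrayPoly f) = arrayPoly fun i j => f i (j + 1) := by
  simp only [arrayPoly, map_sum, Derivation.map_smul]
  refine Finset.sum_congr rfl fun i _ => ?_
  rw [Finset.sum_range_succ', Finset.sum_range_succ _ 5]
  simp [pderiv_y_xyzMonomial_zero, pderiv_y_xyzMonomial_succ, hf]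

theorem pderiv_t_arrayPoly (f : ℕ → ℕ → Fin n → F) : pderiv 3 (arrayPoly f) = 0 := by
  simp [arrayPoly, pderiv_t_xyzMonomial]

theorem coeff_arrayPoly (f : ℕ → ℕ → Fin n → F) {i j : ℕ} (hi : i < 9) (hj : j < 6) (k : Fin n) :
    coeff (xyzExponent i j k) (arrayPoly f) = f i j k * (i.factorial * j.factorial : F)⁻¹ := by
  simp only [arrayPoly, xyzMonomial, coeff_sum, coeff_smul, coeff_monomial, xyzExponent_inj]
  rw [Finset.sum_eq_single i, Finset.sum_eq_single j, Finset.sum_eq_single k]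
  · simp
  · intro k' _ h
    simp [Fin.val_inj, h]
  · simp
  · intro j' _ h
    simp [h]
  · simp [hj]
  · intro i' _ h
    simp [h]
  · simp [hi]

/-- The vector field `α ∂/∂x + β ∂/∂y + f ∂/∂t` of an element of the shift algebra. -/
noncomputable def toWitt (n : ℕ) : ShiftAlgebra F (Fin n → F) →ₗ[F] WittAlgebra 4 F where
  toFun a := a.cx • pderiv 0 + a.cy • pderiv 1 + arrayPoly a.array • pderiv 3
  map_add' a b := by
    have h : arrayPoly (a + b).array = arrayPoly a.array + arrayPoly b.array :=
      arrayPoly_add a.array b.array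
    rw [h]
    simp only [ShiftAlgebra.cx_add, ShiftAlgebra.cy_add, add_smul]
    abel
  map_smul' r a := by
    have h : arrayPoly (r • a).array = r • arrayPoly a.array := arrayPoly_smul r a.array
    rw [h]
    simp [mul_smul]

theorem toWitt_apply (a : ShiftAlgebra F (Fin n → F)) (g : MvPolynomial (Fin 4) F) :
    toWitt n a g = a.cx • pderiv 0 g + a.cy • pderiv 1 g + arrayPoly a.array * pderiv 3 g := rfl

theorem toWitt_x (a : ShiftAlgebra F (Fin n → F)) : toWitt n a (X 0) = C a.cx := by
  simp [toWitt_apply, pderiv_X, smul_eq_C_mul]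

theorem toWitt_y (a : ShiftAlgebra F (Fin n → F)) : toWitt n a (X 1) = C a.cy := by
  simp [toWitt_apply, pderiv_X, smul_eq_C_mul]

theorem toWitt_z (a : ShiftAlgebra F (Fin n → F)) : toWitt n a (X 2) = 0 := by
  simp [toWitt_apply, pderiv_X]

theorem toWitt_t (a : ShiftAlgebra F (Fin n → F)) : toWitt n a (X 3) = arrayPoly a.array := by
  simp [toWitt_apply, pderiv_X]

namespace MatrixPair

variable [CharZero F] (p : MatrixPair F)

theorem toWitt_arrayPoly (a : ShiftAlgebra F (Fin p.size → F)) {b : ShiftAlgebra F (Fin p.size → F)}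
    (hb : b ∈ p.model) : toWitt p.size a (arrayPoly b.array) =
      arrayPoly fun i j => a.cx • b.array (i + 1) j + a.cy • b.array i (j + 1) := by
  rw [toWitt_apply, pderiv_x_arrayPoly fun j => hb.1 9 j (by omega),
    pderiv_y_arrayPoly fun i => hb.1 i 6 (by omega), pderiv_t_arrayPoly, mul_zero, add_zero,
    arrayPoly_add, arrayPoly_smul, arrayPoly_smul]

/-- The realization of the algebra of a matrix pair by polynomial vector fields. -/
noncomputable def realization : p.model →ₗ⁅F⁆ WittAlgebra 4 F where
  toLinearMap := toWitt p.size ∘ₗ p.model.toSubmodule.subtype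
  map_lie' {a b} := by
    refine derivation_ext fun s => ?_
    change toWitt p.size ⁅a.1, b.1⁆ (X s) = ⁅toWitt p.size a.1, toWitt p.size b.1⁆ (X s)
    rw [Derivation.commutator_apply]
    fin_cases s
    · change toWitt p.size _ (X 0) = toWitt p.size _ (toWitt p.size _ (X 0)) -
        toWitt p.size _ (toWitt p.size _ (X 0))
      simp [toWitt_x]
    · change toWitt p.size _ (X 1) = toWitt p.size _ (toWitt p.size _ (X 1)) -
        toWitt p.size _ (toWitt p.size _ (X 1))
      simp [toWitt_y]
    · change toWitt p.size _ (X 2) = toWitt p.size _ (toWitt p.size _ (X 2)) -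
        toWitt p.size _ (toWitt p.size _ (X 2))
      simp [toWitt_z]
    · change toWitt p.size _ (X 3) = toWitt p.size _ (toWitt p.size _ (X 3)) -
        toWitt p.size _ (toWitt p.size _ (X 3))
      rw [toWitt_t, toWitt_t, toWitt_t, toWitt_arrayPoly p a.1 b.2, toWitt_arrayPoly p b.1 a.2,
        ← arrayPoly_sub]
      rfl

theorem realization_injective : Function.Injective p.realization := by
  refine (injective_iff_map_eq_zero p.realization).2 fun a ha => ?_
  have ha' : toWitt p.size a.1 = 0 := ha
  have hX := toWitt_x a.1
  have hY := toWitt_y a.1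
  have hT := toWitt_t a.1
  rw [ha'] at hX hY hT
  refine Subtype.ext (ShiftAlgebra.ext ?_ ?_ fun i j => ?_)
  · simpa using hX.symm
  · simpa using hY.symm
  · by_cases h : 8 < i + j ∨ 5 < j
    · exact a.2.1 i j h
    · ext k
      have h₁ := coeff_arrayPoly a.1.array (i := i) (j := j) (by omega) (by omega) k
      rw [← hT] at h₁
      simpa [Nat.factorial_ne_zero] using h₁.symm

end MatrixPair

end Realization

/-! ### The template and the basis it describes -/

/-- The indices of the free parameters of an admissible array: the positions `(i, j)` with
`i + j ≤ 7`, `j ≤ 5`, and one index for the homogeneous part of degree `8`. -/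
abbrev BlockIndex : Type := Option {c : Fin 8 × Fin 6 // c.1.val + c.2.val ≤ 7}

/-- The block of the coordinate matrix that expresses the entry at `(i, j)` of an admissible array
through the free parameter with the given index. -/
noncomputable def blockPoly (F : Type*) [Field F] (i j : ℕ) : BlockIndex → FreeAlgebra F (Fin 2)
  | none => if i + j = 8 then topPoly F j else 0
  | some c => if c.1.1.val = i ∧ c.1.2.val = j then 1 else 0

/-- The template with fixed vectors `∂/∂x`, `∂/∂y` whose frame consists of the vector fields
`x ^ i / i! * y ^ j / j! * z ^ k ∂/∂t` with `i ≤ 8`, `j ≤ 5`. -/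
noncomputable def wittTemplate (F : Type*) [Field F] : PairTemplate F (WittAlgebra 4 F) where
  fixedCount := 2
  blockRows := 9 * 6
  blockCols := Fintype.card BlockIndex
  fixedVec := ![pderiv 0, pderiv 1]
  frame d k := xyzMonomial F (finProdFinEquiv.symm d).1 (finProdFinEquiv.symm d).2 k • pderiv 3
  block d c := blockPoly F (finProdFinEquiv.symm d).1 (finProdFinEquiv.symm d).2
    ((Fintype.equivFin BlockIndex).symm c)

namespace MatrixPair

variable {F : Type*} [Field F] (p : MatrixPair F)

/-- The admissible array with given free parameters. -/
noncomputable def arrayOfParams (g : BlockIndex → Fin p.size → F) (i j : ℕ) : Fin p.size → F :=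
  ∑ c, (p.eval (blockPoly F i j c)).mulVec (g c)

variable {p}

theorem arrayOfParams_lower (g : BlockIndex → Fin p.size → F)
    (c : {c : Fin 8 × Fin 6 // c.1.val + c.2.val ≤ 7}) :
    p.arrayOfParams g c.1.1 c.1.2 = g (some c) := by
  rw [arrayOfParams, Finset.sum_eq_single (some c)]
  · simp [blockPoly]
  · rintro (_ | d) - hd
    · have := c.2
      simp [blockPoly, show ¬ c.1.1.val + c.1.2.val = 8 by omega]
    · have : ¬ (d.1.1.val = c.1.1.val ∧ d.1.2.val = c.1.2.val) := fun h =>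
        hd (congrArg some (Subtype.ext (Prod.ext (Fin.ext h.1) (Fin.ext h.2))))
      simp [blockPoly, this]
  · simp

theorem arrayOfParams_top (g : BlockIndex → Fin p.size → F) {i j : ℕ} (h : i + j = 8) :
    p.arrayOfParams g i j = (p.eval (topPoly F j)).mulVec (g none) := by
  rw [arrayOfParams, Finset.sum_eq_single none]
  · simp [blockPoly, h]
  · rintro (_ | d) - hd
    · exact absurd rfl hd
    · have : ¬ (d.1.1.val = i ∧ d.1.2.val = j) := by
        have := d.2
        omega
      simp [blockPoly, this]
  · simp

theorem arrayOfParams_outside (g : BlockIndex → Fin p.size → F) {i j : ℕ}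
    (h : 8 < i + j ∨ 5 < j) : p.arrayOfParams g i j = 0 := by
  refine Finset.sum_eq_zero ?_
  rintro (_ | d) -
  · by_cases h' : i + j = 8
    · simp [blockPoly, h', eval_topPoly_of_lt p (show 5 < j by omega)]
    · simp [blockPoly, h']
  · have : ¬ (d.1.1.val = i ∧ d.1.2.val = j) := by
      have := d.2
      omega
    simp [blockPoly, this]

/-- The free parameters of an array. -/
def params {V : Type*} (f : ℕ → ℕ → V) : BlockIndex → V
  | none => f 3 5
  | some c => f c.1.1 c.1.2

theorem arrayOfParams_params {a : ShiftAlgebra F (Fin p.size → F)} (ha : a ∈ p.model) :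
    p.arrayOfParams (params a.array) = a.array := by
  funext i j
  by_cases h : 8 < i + j ∨ 5 < j
  · rw [arrayOfParams_outside _ h, ha.1 i j h]
  · by_cases h' : i + j = 8
    · rw [arrayOfParams_top _ h', ha.2 i j h']
      rfl
    · exact arrayOfParams_lower (params a.array)
        ⟨(⟨i, by omega⟩, ⟨j, by omega⟩), show i + j ≤ 7 by omega⟩

theorem params_arrayOfParams (g : BlockIndex → Fin p.size → F) :
    params (p.arrayOfParams g) = g := by
  funext c
  rcases c with _ | c
  · exact (arrayOfParams_top g (i := 3) rfl).trans
      (by rw [eval_topPoly_five, Matrix.one_mulVec])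
  · exact arrayOfParams_lower g c

/-- Coordinates on the algebra of a matrix pair: the two coefficients of the shifts and the free
parameters of the array. -/
noncomputable def coordEquiv (p : MatrixPair F) :
    p.model ≃ₗ[F] (Fin 2 ⊕ (BlockIndex × Fin p.size) → F) where
  toFun a := Sum.elim ![a.1.cx, a.1.cy] fun s => params a.1.array s.1 s.2
  invFun x := ⟨ShiftAlgebra.of (x (Sum.inl 0)) (x (Sum.inl 1))
    (p.arrayOfParams fun c k => x (Sum.inr (c, k))), by
      refine mem_model.2 ⟨fun i j h => ?_, fun i j h => ?_⟩
      · rw [ShiftAlgebra.array_of, arrayOfParams_outside _ h]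
      · rw [ShiftAlgebra.array_of, arrayOfParams_top _ h, arrayOfParams_top _ (i := 3) rfl,
          eval_topPoly_five, Matrix.one_mulVec]⟩
  map_add' a b := by
    funext s
    rcases s with s | ⟨_ | c, k⟩
    · fin_cases s <;> rfl
    · rfl
    · rfl
  map_smul' r a := by
    funext s
    rcases s with s | ⟨_ | c, k⟩
    · fin_cases s <;> rfl
    · rfl
    · rfl
  left_inv a := Subtype.ext (ShiftAlgebra.ext rfl rfl fun i j => by
    exact congrFun (congrFun (arrayOfParams_params a.2) i) j)
  right_inv x := by
    funext s
    rcases s with s | ⟨c, k⟩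
    · fin_cases s <;> rfl
    · exact congrFun (congrFun (params_arrayOfParams fun c k => x (Sum.inr (c, k))) c) k

theorem coordEquiv_symm_array (p : MatrixPair F) (x : Fin 2 ⊕ (BlockIndex × Fin p.size) → F)
    (i j : ℕ) : (p.coordEquiv.symm x).1.array i j =
      p.arrayOfParams (fun c k => x (Sum.inr (c, k))) i j := rfl

/-- The basis dual to the coordinates. -/
noncomputable def modelBasis (p : MatrixPair F) :
    Module.Basis (Fin 2 ⊕ (BlockIndex × Fin p.size)) F p.model :=
  Module.Basis.ofEquivFun p.coordEquiv

theorem modelBasis_inl (p : MatrixPair F) (s : Fin 2) :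
    (p.modelBasis (Sum.inl s)).1 = ShiftAlgebra.of ((Pi.single s 1 : Fin 2 → F) 0) ((Pi.single s 1 : Fin 2 → F) 1) 0 := by
  classical
  have h : p.modelBasis (Sum.inl s) = p.coordEquiv.symm (Pi.single (Sum.inl s) 1) := by
    rw [modelBasis, Module.Basis.coe_ofEquivFun]
  rw [h]
  refine ShiftAlgebra.ext ?_ ?_ fun i j => ?_
  · change Pi.single (M := fun _ => F) (Sum.inl s) 1 (Sum.inl 0) = (Pi.single s 1 : Fin 2 → F) 0
    simp [Pi.single_apply]
  · change Pi.single (M := fun _ => F) (Sum.inl s) 1 (Sum.inl 1) = (Pi.single s 1 : Fin 2 → F) 1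
    simp [Pi.single_apply]
  · rw [coordEquiv_symm_array]
    refine Finset.sum_eq_zero fun c _ => ?_
    have : (fun l => Pi.single (M := fun _ => F) (Sum.inl s) 1
        (Sum.inr (c, l) : Fin 2 ⊕ (BlockIndex × Fin p.size))) = 0 := by
      funext l
      simp
    beta_reduce
    rw [this, Matrix.mulVec_zero]

theorem modelBasis_inr (p : MatrixPair F) (c : BlockIndex) (k : Fin p.size) :
    (p.modelBasis (Sum.inr (c, k))).1 =
      ShiftAlgebra.of 0 0 fun i j => (p.eval (blockPoly F i j c)).col k := by
  classical
  have h : p.modelBasis (Sum.inr (c, k)) = p.coordEquiv.symm (Pi.single (Sum.inr (c, k)) 1) := by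
    rw [modelBasis, Module.Basis.coe_ofEquivFun]
  rw [h]
  refine ShiftAlgebra.ext ?_ ?_ fun i j => ?_
  · change Pi.single (M := fun _ => F) (Sum.inr (c, k)) 1 (Sum.inl 0) = 0
    simp
  · change Pi.single (M := fun _ => F) (Sum.inr (c, k)) 1 (Sum.inl 1) = 0
    simp
  · rw [coordEquiv_symm_array, ShiftAlgebra.array_of]
    refine (Finset.sum_eq_single c (fun d _ hd => ?_)
      (fun hc => absurd (Finset.mem_univ c) hc)).trans ?_
    · have : (fun l => Pi.single (M := fun _ => F) (Sum.inr (c, k)) 1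
          (Sum.inr (d, l) : Fin 2 ⊕ (BlockIndex × Fin p.size))) = 0 := by
        funext l
        simp [hd]
      beta_reduce
      rw [this, Matrix.mulVec_zero]
    · have : (fun l => Pi.single (M := fun _ => F) (Sum.inr (c, k)) 1
          (Sum.inr (c, l) : Fin 2 ⊕ (BlockIndex × Fin p.size))) = Pi.single k 1 := by
        funext l
        simp [Pi.single_apply]
      beta_reduce
      rw [this, Matrix.mulVec_single_one]

/-- The bijection between the index set of `PairTemplate.vec` and that of `modelBasis`. -/
noncomputable def vecIndexEquiv (p : MatrixPair F) :
    Fin (wittTemplate F).fixedCount ⊕ (Fin (wittTemplate F).blockCols × Fin p.size) ≃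
      Fin 2 ⊕ (BlockIndex × Fin p.size) :=
  Equiv.sumCongr (Equiv.refl (Fin 2))
    (Equiv.prodCongr (Fintype.equivFin BlockIndex).symm (Equiv.refl _))

theorem vec_wittTemplate [CharZero F] (p : MatrixPair F) :
    (wittTemplate F).vec p = p.realization ∘ p.modelBasis ∘ p.vecIndexEquiv := by
  funext s
  rcases s with s | ⟨c, k⟩
  · have h : ∀ s : Fin 2, (![pderiv 0, pderiv 1] : Fin 2 → WittAlgebra 4 F) s =
        toWitt p.size (p.modelBasis (Sum.inl s)).1 := by
      intro s
      have h : arrayPoly (n := p.size) (0 : ℕ → ℕ → Fin p.size → F) = 0 := by simp [arrayPoly]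
      rw [modelBasis_inl]
      ext i : 1
      rw [toWitt_apply, ShiftAlgebra.array_of, h]
      fin_cases s <;> simp
    exact h s
  · change ∑ d : Fin (9 * 6), ∑ i : Fin p.size, p.eval (blockPoly F (finProdFinEquiv.symm d).1
      (finProdFinEquiv.symm d).2 ((Fintype.equivFin BlockIndex).symm c)) i k •
        (xyzMonomial F (finProdFinEquiv.symm d).1 (finProdFinEquiv.symm d).2 i •
          (pderiv 3 : WittAlgebra 4 F)) =
      toWitt p.size (p.modelBasis (Sum.inr ((Fintype.equivFin BlockIndex).symm c, k))).1
    rw [modelBasis_inr, ← finProdFinEquiv.sum_comp, Fintype.sum_prod_type]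
    change _ = (0 : F) • (pderiv 0 : WittAlgebra 4 F) + (0 : F) • (pderiv 1 : WittAlgebra 4 F) +
      arrayPoly _ • (pderiv 3 : WittAlgebra 4 F)
    simp only [zero_smul, zero_add, arrayPoly, Finset.sum_smul, smul_assoc, Finset.sum_range,
      Equiv.symm_apply_apply, ShiftAlgebra.array_of, Matrix.col_apply]

end MatrixPair

/-! ### Wildness -/

theorem theorem2 (F : Type*) [Field F] [CharZero F] :
    IsWildSubalgebraProblem F (WittAlgebra 4 F)
      (fun L => FiniteDimensional F L ∧ LieRing.IsNilpotent L) := by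
  have equiv (p : MatrixPair F) : p.model ≃ₗ⁅F⁆ p.realization.range :=
    LieEquiv.ofInjective p.realization p.realization_injective
  refine ⟨wittTemplate F, fun p => p.realization.range, fun p => ⟨⟨?_, ?_⟩, ?_, ?_⟩,
    fun p q => ⟨?_, ?_⟩⟩
  · have := Module.Finite.of_basis p.modelBasis
    exact Module.Finite.equiv (equiv p).toLinearEquiv
  · have := Module.Finite.of_basis p.modelBasis
    exact (LieEquiv.nilpotent_iff_equiv_nilpotent (equiv p)).1 p.isNilpotent_model
  · rw [p.vec_wittTemplate, ← Function.comp_assoc]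
    exact (p.modelBasis.linearIndependent.map' p.realization.toLinearMap
      (LinearMap.ker_eq_bot.2 p.realization_injective)).comp _ p.vecIndexEquiv.injective
  · rw [p.vec_wittTemplate, ← Function.comp_assoc, p.vecIndexEquiv.surjective.range_comp,
      Set.range_comp]
    change LinearMap.range p.realization.toLinearMap =
      Submodule.span F (p.realization.toLinearMap '' Set.range p.modelBasis)
    rw [← Submodule.map_span, p.modelBasis.span_eq, Submodule.map_top]
  · rintro ⟨φ⟩
    exact MatrixPair.similar_of_model_equiv (((equiv p).trans φ).trans (equiv q).symm)
  · intro h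
    obtain ⟨φ⟩ := h.nonempty_model_equiv
    exact ⟨((equiv p).symm.trans φ).trans (equiv q)⟩
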